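/- Work in max algebra on $\mathbb{R}_+=[0,\infty)$: $a\oplus b=\max(a,b)$, $a\otimes b=ab$, with the induced products of matrices and vectors; all powers and products of matrices below are max-algebraic. Let $A\in\mathbb{R}_+^{n\times n}$, let $D(A)$ be the digraph on $\{1,\dots,n\}$ with the edges $(i,j)$, $a_{ij}\neq 0$, and let $\lambda(A)$ be the maximum, over the cycles $(i_1,\dots,i_k,i_1)$ of $D(A)$ with $1\le k\le n$, of $(a_{i_1i_2}\cdots a_{i_ki_1})^{1/k}$ ($\lambda(A)=0$ if there are no cycles). A cycle is critical if its geometric mean equals $\lambda(A)$; the critical digraph $\mathcal{C}(A)$ consists of all nodes and edges on critical cycles. The cyclicity of a strongly connected digraph is the gcd of the lengths of its simple cycles; the cyclicity of a digraph made of several such components is the lcm of their cyclicities. Ultimate expansion. Put $K_1^\circ=\{1,\dots,n\}$. Given $K_\mu^\circ$, let $A_\mu^\circ$ be $A$ with all entries outside $K_\mu^\circ\times K_\mu^\circ$ replaced by $0$ and let $\lambda_\mu=\lambda(A_\mu^\circ)$. Stop if $\lambda_\mu=0$. Otherwise let $\mathcal{C}_\mu^\circ=(N_\mu^\circ,E_\mu^\circ)$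 be the critical digraph of $A_\mu^\circ$, $\gamma_\mu^\circ$ its cyclicity, $M_\mu^\circ$ the set of all nodes in the strongly connected components of $D(A)$ that meet $N_\mu^\circ$, and $K_{\mu+1}^\circ=K_\mu^\circ\setminus M_\mu^\circ$. Let $\Sigma$ be the set of the indices $\mu$ with $\lambda_\mu\neq0$, and let $\gamma^\circ$ be the lcm of the $\gamma_\mu^\circ$, $\mu\in\Sigma$. For $\mu\in\Sigma$ let $B_\mu=\bigoplus_{k\ge0}\big((A_\mu^\circ/\lambda_\mu)^{\gamma_\mu^\circ}\big)^k$, let $C_\mu$ (resp. $R_\mu$) be obtained from $B_\mu$ by replacing all columns (resp. rows) with indices outside $N_\mu^\circ$ by $0$, let $S_\mu$ be obtained from $A_\mu^\circ/\lambda_\mu$ by replacing all entries outside $E_\mu^\circ$ by $0$, and let $U_\mu^{(t)}=C_\mu S_\mu^tR_\mu$. For $y\in\mathbb{R}_+^n$ the sequence $\{A^ty,\ t\ge0\}$ is called ultimately linear periodic if there is $\lambda(y)\in\mathbb{R}_+$ with $A^{t+\gamma^\circ}y=\lambda(y)^{\gamma^\circ}A^ty$ for all sufficiently large $t$. The matrix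 $A$ is called orbit periodic if this holds for every $y\in\mathbb{R}_+^n$. Write $\operatorname{supp}(y)=\{i: y_i\neq0\}$ and let $e_i$ be the $i$-th unit vector. Theorem. Suppose that $\{A^te_i,\ t\ge0\}$ is ultimately linear periodic for every node $i$ that lies on a cycle of $D(A)$. Then $A$ is orbit periodic if and only if for all $\mu,\nu\in\Sigma$ $$\lambda_\mu<\lambda_\nu\ \Longrightarrow\ \bigcup_{i\in N_\mu^\circ}\operatorname{supp}(U_\mu^{(1)}e_i)\subseteq\bigcap_{j\in N_\nu^\circ}\operatorname{supp}(U_\nu^{(1)}e_j).$$ -/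

import Mathlib

open scoped NNReal

namespace MaxAlg

noncomputable section

/-! ### Max algebra over the nonnegative reals: `a ⊕ b = max a b`, `a ⊗ b = a * b` -/

/-- Max-algebraic matrix product, `(A ⊗ B) i j = max_k A i k * B k j` (`⊥ = 0` in `ℝ≥0`). -/
def mul {n : ℕ} (A B : Matrix (Fin n) (Fin n) ℝ≥0) : Matrix (Fin n) (Fin n) ℝ≥0 :=
  fun i j => Finset.univ.sup fun k => A i k * B k j

/-- Max-algebraic product of a matrix and a vector. -/
def mulVec {n : ℕ} (A : Matrix (Fin n) (Fin n) ℝ≥0) (y : Fin n → ℝ≥0) : Fin n → ℝ≥0 :=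
  fun i => Finset.univ.sup fun k => A i k * y k

/-- Max-algebraic power `A ^ t`, with `A ^ 0 = I`. -/
def pow {n : ℕ} (A : Matrix (Fin n) (Fin n) ℝ≥0) : ℕ → Matrix (Fin n) (Fin n) ℝ≥0
  | 0 => 1
  | t + 1 => mul (pow A t) A

/-- Kleene star `I ⊕ A ⊕ A² ⊕ …`, entrywise supremum of all max-algebraic powers. It is only
used for matrices of maximum cycle geometric mean `1`, for which the supremum is finite. -/
def kleeneStar {n : ℕ} (A : Matrix (Fin n) (Fin n) ℝ≥0) : Matrix (Fin n) (Fin n) ℝ≥0 :=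
  fun i j => ⨆ t : ℕ, pow A t i j

/-- The unit vector `e_i`. -/
def unitVec {n : ℕ} (i : Fin n) : Fin n → ℝ≥0 := Pi.single i 1

/-- Support of a vector. -/
def supp {n : ℕ} (y : Fin n → ℝ≥0) : Set (Fin n) := {i | y i ≠ 0}

/-! ### Digraphs, given by their edge relation on the nodes `Fin n` -/

/-- The edge relation of the digraph associated with `A`. -/
def edge {n : ℕ} (A : Matrix (Fin n) (Fin n) ℝ≥0) (i j : Fin n) : Prop := A i j ≠ 0

/-- `c 0, c 1, …, c k = c 0` is a cycle of length `k ≥ 1` (nodes may be repeated). The values of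
`c` beyond `k` are irrelevant. -/
structure IsCycle {n : ℕ} (E : Fin n → Fin n → Prop) (k : ℕ) (c : ℕ → Fin n) : Prop where
  pos : 1 ≤ k
  closed : c k = c 0
  edges : ∀ t < k, E (c t) (c (t + 1))

/-- A simple cycle: `c 0, …, c (k - 1)` are pairwise distinct. -/
def IsSimpleCycle {n : ℕ} (E : Fin n → Fin n → Prop) (k : ℕ) (c : ℕ → Fin n) : Prop :=
  IsCycle E k c ∧ Set.InjOn c (Set.Iio k)

/-- The node `i` belongs to some cycle, i.e. it lies in a nontrivial component. -/
def OnCycle {n : ℕ} (E : Fin n → Fin n → Prop) (i : Fin n) : Prop :=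
  ∃ k c, IsCycle E k c ∧ ∃ t < k, c t = i

/-- `i` and `j` are in the same strongly connected component (paths of length `0` are allowed). -/
def SameComp {n : ℕ} (E : Fin n → Fin n → Prop) (i j : Fin n) : Prop :=
  Relation.ReflTransGen E i j ∧ Relation.ReflTransGen E j i

open scoped Classical in
/-- Cyclicity of the strongly connected component of the node `i`: the gcd of the lengths of all
simple cycles in this component. (A simple cycle has length at most `n`.) -/
def compCyclicity {n : ℕ} (E : Fin n → Fin n → Prop) (i : Fin n) : ℕ :=
  ((Finset.range (n + 1)).filter
    fun k => ∃ c, IsSimpleCycle E k c ∧ SameComp E (c 0) i).gcd id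

open scoped Classical in
/-- Cyclicity of a digraph with several components: the lcm of the cyclicities of its
(nontrivial) components. -/
def cyclicity {n : ℕ} (E : Fin n → Fin n → Prop) : ℕ :=
  (Finset.univ.filter fun i => OnCycle E i).lcm (compCyclicity E)

/-! ### Maximum cycle geometric mean and the critical digraph -/

/-- Weight of the cycle `c` of length `k`. -/
def weight {n : ℕ} (A : Matrix (Fin n) (Fin n) ℝ≥0) (k : ℕ) (c : ℕ → Fin n) : ℝ≥0 :=
  ∏ t ∈ Finset.range k, A (c t) (c (t + 1))

/-- Geometric mean of the cycle `c` of length `k`. -/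
def geoMean {n : ℕ} (A : Matrix (Fin n) (Fin n) ℝ≥0) (k : ℕ) (c : ℕ → Fin n) : ℝ≥0 :=
  weight A k c ^ (1 / (k : ℝ))

/-- Maximum cycle geometric mean: the maximum (of a finite set) of the geometric means of all
cycles of length at most `n` in the digraph of `A`; it is `0` if there are no cycles. -/
def mcgm {n : ℕ} (A : Matrix (Fin n) (Fin n) ℝ≥0) : ℝ≥0 :=
  sSup {x | ∃ k c, k ≤ n ∧ IsCycle (edge A) k c ∧ x = geoMean A k c}

/-- Critical cycles: cycles whose geometric mean is the maximal one. -/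
def IsCritCycle {n : ℕ} (A : Matrix (Fin n) (Fin n) ℝ≥0) (k : ℕ) (c : ℕ → Fin n) : Prop :=
  IsCycle (edge A) k c ∧ geoMean A k c = mcgm A

/-- Critical nodes. -/
def critNodes {n : ℕ} (A : Matrix (Fin n) (Fin n) ℝ≥0) : Set (Fin n) :=
  {i | ∃ k c, IsCritCycle A k c ∧ ∃ t < k, c t = i}

/-- Critical edges, i.e. the edge relation of the critical digraph. -/
def critEdge {n : ℕ} (A : Matrix (Fin n) (Fin n) ℝ≥0) (i j : Fin n) : Prop :=
  ∃ k c, IsCritCycle A k c ∧ ∃ t < k, c t = i ∧ c (t + 1) = j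

/-! ### CSR products -/

/-- `A / λ(A)`. -/
def normalize {n : ℕ} (A : Matrix (Fin n) (Fin n) ℝ≥0) : Matrix (Fin n) (Fin n) ℝ≥0 :=
  fun i j => A i j / mcgm A

/-- The Kleene star `B = ((A / λ(A)) ^ γ)^*`, where `γ` is the cyclicity of the critical
digraph of `A`. -/
def starB {n : ℕ} (A : Matrix (Fin n) (Fin n) ℝ≥0) : Matrix (Fin n) (Fin n) ℝ≥0 :=
  kleeneStar (pow (normalize A) (cyclicity (critEdge A)))

open scoped Classical in
/-- `C`: the columns of `B` with critical indices, the other columns being `0`. -/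
def matC {n : ℕ} (A : Matrix (Fin n) (Fin n) ℝ≥0) : Matrix (Fin n) (Fin n) ℝ≥0 :=
  fun i j => if j ∈ critNodes A then starB A i j else 0

open scoped Classical in
/-- `R`: the rows of `B` with critical indices, the other rows being `0`. -/
def matR {n : ℕ} (A : Matrix (Fin n) (Fin n) ℝ≥0) : Matrix (Fin n) (Fin n) ℝ≥0 :=
  fun i j => if i ∈ critNodes A then starB A i j else 0

open scoped Classical in
/-- `S`: the critical entries of `A / λ(A)`, the other entries being `0`. -/
def matS {n : ℕ} (A : Matrix (Fin n) (Fin n) ℝ≥0) : Matrix (Fin n) (Fin n) ℝ≥0 :=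
  fun i j => if critEdge A i j then normalize A i j else 0

/-- The product `C S^t R` for the whole critical digraph of `A`. -/
def csr {n : ℕ} (A : Matrix (Fin n) (Fin n) ℝ≥0) (t : ℕ) : Matrix (Fin n) (Fin n) ℝ≥0 :=
  mul (mul (matC A) (pow (matS A) t)) (matR A)

/-! ### The ultimate expansion

Terms are numbered from `0`. The construction runs as long as `λ_μ ≠ 0`; from the first `μ` with
`λ_μ = 0` on, nothing changes any more and `λ` remains `0`. -/

open scoped Classical in
/-- The matrix `A` with all entries outside `K × K` replaced by `0`. -/
def restrict {n : ℕ} (A : Matrix (Fin n) (Fin n) ℝ≥0) (K : Set (Fin n)) :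
    Matrix (Fin n) (Fin n) ℝ≥0 :=
  fun i j => if i ∈ K ∧ j ∈ K then A i j else 0

/-- The nodes of all components of the digraph of `A` that contain a critical node of the
restriction of `A` to `K`. -/
def hitNodes {n : ℕ} (A : Matrix (Fin n) (Fin n) ℝ≥0) (K : Set (Fin n)) : Set (Fin n) :=
  {i | ∃ j ∈ critNodes (restrict A K), SameComp (edge A) i j}

/-- The node set `K_μ` left before step `μ`. -/
def ultK {n : ℕ} (A : Matrix (Fin n) (Fin n) ℝ≥0) : ℕ → Set (Fin n)
  | 0 => Set.univ
  | μ + 1 => ultK A μ \ hitNodes A (ultK A μ)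

/-- The matrix `A_μ`. -/
def ultA {n : ℕ} (A : Matrix (Fin n) (Fin n) ℝ≥0) (μ : ℕ) : Matrix (Fin n) (Fin n) ℝ≥0 :=
  restrict A (ultK A μ)

/-- `λ_μ`, the maximum cycle geometric mean of `A_μ`. -/
def ultLam {n : ℕ} (A : Matrix (Fin n) (Fin n) ℝ≥0) (μ : ℕ) : ℝ≥0 := mcgm (ultA A μ)

/-- The indices of the terms of the ultimate expansion. -/
def ultIndex {n : ℕ} (A : Matrix (Fin n) (Fin n) ℝ≥0) : Set ℕ := {μ | ultLam A μ ≠ 0}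

/-- `N_μ`, the node set of the critical digraph of `A_μ`. -/
def ultN {n : ℕ} (A : Matrix (Fin n) (Fin n) ℝ≥0) (μ : ℕ) : Set (Fin n) := critNodes (ultA A μ)

/-- The ultimate term `U_μ^{(t)} = C_μ S_μ^t R_μ`. -/
def ultTerm {n : ℕ} (A : Matrix (Fin n) (Fin n) ℝ≥0) (μ t : ℕ) : Matrix (Fin n) (Fin n) ℝ≥0 :=
  csr (ultA A μ) t

open scoped Classical in
/-- The joint cyclicity: the lcm of the cyclicities of the critical digraphs of all `A_μ`.
(There are at most `n` terms, as each step removes a node.) -/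
def ultCyclicity {n : ℕ} (A : Matrix (Fin n) (Fin n) ℝ≥0) : ℕ :=
  ((Finset.range n).filter fun μ => μ ∈ ultIndex A).lcm fun μ => cyclicity (critEdge (ultA A μ))

/-! ### Orbit periodicity -/

/-- The sequence `A ^ t ⊗ y` is ultimately linear periodic. -/
def UltLinPeriodic {n : ℕ} (A : Matrix (Fin n) (Fin n) ℝ≥0) (y : Fin n → ℝ≥0) : Prop :=
  ∃ r : ℝ≥0, ∃ T : ℕ, ∀ t ≥ T, ∀ i,
    mulVec (pow A (t + ultCyclicity A)) y i = r ^ ultCyclicity A * mulVec (pow A t) y i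

/-- `A` is orbit periodic. -/
def OrbitPeriodic {n : ℕ} (A : Matrix (Fin n) (Fin n) ℝ≥0) : Prop :=
  ∀ y : Fin n → ℝ≥0, UltLinPeriodic A y

end

end MaxAlg

/-!
The columns of `A ^ t` at the nodes on cycles grow geometrically, with rate `λ_μ` on the component
of `N_μ`. When `A ^ t y` is a maximum of such columns, the fastest of them has to determine the
whole vector, so it must eventually be supported wherever a slower one is. Since the period is a
multiple of all the cyclicities, the support of `U_μ^{(1)} e_i` consists of the starting nodes of
the walks to `i` of length `1` modulo `γ_μ`, hence of the support of `A ^ t e_i` for all large `t`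
in that residue class; the inclusions between these sets thus say that faster columns eventually
have larger supports. Following walks to and along critical cycles turns this one residue class
into all large lengths.
-/

namespace MaxAlg

open Filter Relation Topology

section UltGeometric

variable {g : ℕ} {r s : ℝ≥0} {a b : ℕ → ℝ≥0}

/-- A sequence is ultimately geometric with period `g` and rate `r` if it is ultimately multiplied
by `r ^ g` over each period. This is the behaviour of the entries of linear periodic orbits. -/
def UltGeometric (g : ℕ) (r : ℝ≥0) (a : ℕ → ℝ≥0) : Prop :=
  ∀ᶠ t in atTop, a (t + g) = r ^ g * a t

namespace UltGeometric

lemma zero : UltGeometric g r fun _ => 0 := by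
  simp [UltGeometric]

lemma pow_self : UltGeometric g r fun t => r ^ t :=
  .of_forall fun t => by simp only [pow_add, mul_comm]

lemma congr (ha : UltGeometric g r a) (h : a =ᶠ[atTop] b) : UltGeometric g r b := by
  filter_upwards [ha, h, (tendsto_add_atTop_nat g).eventually h] with t ht h₀ h₁
  rw [← h₀, ← h₁, ht]

lemma const_mul (c : ℝ≥0) (ha : UltGeometric g r a) : UltGeometric g r fun t => c * a t := by
  filter_upwards [ha] with t ht
  rw [ht, mul_left_comm]

lemma sup (ha : UltGeometric g r a) (hb : UltGeometric g r b) :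
    UltGeometric g r fun t => a t ⊔ b t := by
  filter_upwards [ha, hb] with t hat hbt
  rw [hat, hbt, mul_max]

lemma div (ha : UltGeometric g r a) (hb : UltGeometric g s b) :
    UltGeometric g (r / s) fun t => a t / b t := by
  filter_upwards [ha, hb] with t hat hbt
  rw [hat, hbt, div_pow, mul_div_mul_comm]

lemma comp_add_iff (d : ℕ) : UltGeometric g r (fun t => a (t + d)) ↔ UltGeometric g r a := by
  conv_rhs => rw [UltGeometric, ← map_add_atTop_eq_nat d, eventually_map]
  simp only [UltGeometric, add_right_comm]

variable [NeZero g]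

lemma tendsto_zero (ha : UltGeometric g r a) (hr : r < 1) : Tendsto a atTop (𝓝 0) := by
  obtain ⟨T, hT⟩ := eventually_atTop.1 ha
  have hiter (u m : ℕ) : a (u + m * g + T) = (r ^ g) ^ m * a (u + T) := by
    induction m with
    | zero => simp
    | succ m ih =>
      rw [show u + (m + 1) * g + T = u + m * g + T + g by ring, hT _ (by omega), ih, pow_succ']
      ring
  rw [← tendsto_add_atTop_iff_nat T]
  have hbound (t : ℕ) :
      a (t + T) ≤ (r ^ g) ^ (t / g) * (Finset.range g).sup fun u => a (u + T) := by
    conv_lhs => rw [← Nat.mod_add_div' t g, hiter]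
    gcongr
    exact Finset.le_sup (f := fun u => a (u + T))
      (Finset.mem_range.2 (t.mod_lt (NeZero.pos g)))
  refine tendsto_of_tendsto_of_tendsto_of_le_of_le tendsto_const_nhds ?_
    (fun _ => zero_le) hbound
  simpa using ((NNReal.tendsto_pow_atTop_nhds_zero_of_lt_one
    (pow_lt_one₀ zero_le hr (NeZero.ne g))).comp
      (Nat.tendsto_div_const_atTop (NeZero.ne g))).mul_const _

lemma eventually_lt (ha : UltGeometric g r a) (hb : UltGeometric g s b) (h : r < s) :
    ∀ᶠ t in atTop, b t ≠ 0 → a t < b t := by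
  have hrs : r / s < 1 := (div_lt_one (zero_le.trans_lt h)).2 h
  filter_upwards [((ha.div hb).tendsto_zero hrs).eventually_lt_const one_pos] with t ht hbt
  exact (div_lt_one (pos_iff_ne_zero.2 hbt)).1 ht

lemma rate_le (ha : UltGeometric g r a) (hb : UltGeometric g s b)
    (h : ∃ᶠ t in atTop, a t ≠ 0 ∧ a t ≤ b t) : r ≤ s := by
  by_contra! hlt
  exact h ((hb.eventually_lt ha hlt).mono fun t ht hab => (ht hab.1).not_ge hab.2)

end UltGeometric

end UltGeometric

section Walks

variable {α : Type*} {E F : α → α → Prop} {γ : ℕ} {i j k : α}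

/-- There is a walk of length `t` from `i` to `j` in the digraph with edge relation `E`. -/
def HasWalk (E : α → α → Prop) : ℕ → α → α → Prop
  | 0, i, j => i = j
  | t + 1, i, j => ∃ k, HasWalk E t i k ∧ E k j

/-- There is a walk from `i` to `j` whose length is in the residue class `s` modulo `γ`. -/
def HasWalkMod (E : α → α → Prop) (γ : ℕ) (s : ZMod γ) (i j : α) : Prop :=
  ∃ t : ℕ, (t : ZMod γ) = s ∧ HasWalk E t i j

lemma hasWalk_one (h : E i j) : HasWalk E 1 i j := ⟨i, rfl, h⟩

lemma HasWalk.trans {s t : ℕ} (h : HasWalk E s i j) (h' : HasWalk E t j k) :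
    HasWalk E (s + t) i k := by
  induction t generalizing k with
  | zero => exact h' ▸ h
  | succ t ih => exact let ⟨l, hl, e⟩ := h'; ⟨l, ih hl, e⟩

lemma HasWalk.mono (hEF : ∀ i j, E i j → F i j) {t : ℕ} (h : HasWalk E t i j) :
    HasWalk F t i j := by
  induction t generalizing j with
  | zero => exact h
  | succ t ih => exact let ⟨l, hl, e⟩ := h; ⟨l, ih hl, hEF _ _ e⟩

lemma hasWalk_of_forall_edge {c : ℕ → α} {t : ℕ} (h : ∀ s < t, E (c s) (c (s + 1))) :
    HasWalk E t (c 0) (c t) := by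
  induction t with
  | zero => rfl
  | succ t ih => exact ⟨c t, ih fun s hs => h s (by omega), h t t.lt_succ_self⟩

lemma HasWalk.exists_forall_edge {t : ℕ} (h : HasWalk E t i j) :
    ∃ c : ℕ → α, c 0 = i ∧ c t = j ∧ ∀ s < t, E (c s) (c (s + 1)) := by
  induction t generalizing j with
  | zero => exact ⟨fun _ => i, rfl, h, fun _ hs => absurd hs (Nat.not_lt_zero _)⟩
  | succ t ih =>
    obtain ⟨k, hk, e⟩ := h
    obtain ⟨c, h0, rfl, hc⟩ := ih hk
    refine ⟨Function.update c (t + 1) j, by simpa using h0, by simp, fun s hs => ?_⟩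
    rcases Nat.lt_succ_iff_lt_or_eq.1 hs with h | rfl
    · simpa [Function.update_of_ne, h.ne, hs.ne] using hc s h
    · simpa using e

lemma reflTransGen_iff_exists_hasWalk : ReflTransGen E i j ↔ ∃ t, HasWalk E t i j := by
  constructor
  · intro h
    induction h with
    | refl => exact ⟨0, rfl⟩
    | tail _ e ih => exact let ⟨t, ht⟩ := ih; ⟨t + 1, _, ht, e⟩
  · rintro ⟨t, h⟩
    induction t generalizing j with
    | zero => exact h ▸ .refl
    | succ t ih => exact let ⟨k, hk, e⟩ := h; (ih hk).tail e

lemma transGen_iff_exists_hasWalk : TransGen E i j ↔ ∃ t, HasWalk E (t + 1) i j := by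
  simp only [TransGen.tail'_iff, reflTransGen_iff_exists_hasWalk, HasWalk]
  exact ⟨fun ⟨k, ⟨t, h⟩, e⟩ => ⟨t, k, h, e⟩, fun ⟨t, k, h, e⟩ => ⟨k, ⟨t, h⟩, e⟩⟩

lemma HasWalkMod.trans {s t : ZMod γ} (h : HasWalkMod E γ s i j) (h' : HasWalkMod E γ t j k) :
    HasWalkMod E γ (s + t) i k := by
  obtain ⟨a, rfl, ha⟩ := h
  obtain ⟨b, rfl, hb⟩ := h'
  exact ⟨a + b, Nat.cast_add a b, ha.trans hb⟩

lemma HasWalkMod.mono (hEF : ∀ i j, E i j → F i j) {s : ZMod γ} (h : HasWalkMod E γ s i j) :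
    HasWalkMod F γ s i j :=
  let ⟨t, ht, hw⟩ := h; ⟨t, ht, hw.mono hEF⟩

lemma hasWalkMod_one (h : E i j) : HasWalkMod E γ 1 i j := ⟨1, Nat.cast_one, hasWalk_one h⟩

lemma hasWalkMod_zero_iff : HasWalkMod E γ 0 i j ↔ ∃ m, HasWalk E (m * γ) i j := by
  constructor
  · rintro ⟨t, ht, h⟩
    obtain ⟨m, rfl⟩ := (ZMod.natCast_eq_zero_iff _ _).1 ht
    exact ⟨m, mul_comm γ m ▸ h⟩
  · rintro ⟨m, h⟩
    exact ⟨m * γ, by simp, h⟩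

lemma HasWalkMod.eventually_hasWalk {s : ZMod γ} (h : HasWalkMod E γ s i j)
    (hj : ∀ᶠ t in atTop, γ ∣ t → HasWalk E t j j) :
    ∀ᶠ t : ℕ in atTop, (t : ZMod γ) = s → HasWalk E t i j := by
  obtain ⟨u, rfl, hu⟩ := h
  filter_upwards [(tendsto_sub_atTop_nat u).eventually hj, eventually_ge_atTop u]
    with t ht hut hs
  have hdvd : γ ∣ t - u := by
    rw [← ZMod.natCast_eq_zero_iff, Nat.cast_sub hut, hs, sub_self]
  exact Nat.add_sub_cancel' hut ▸ hu.trans (ht hdvd)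

lemma eventually_hasWalk_of_forall_hasWalkMod [NeZero γ] (h : ∀ s, HasWalkMod E γ s i j)
    (hj : ∀ᶠ t in atTop, γ ∣ t → HasWalk E t j j) : ∀ᶠ t in atTop, HasWalk E t i j := by
  filter_upwards [eventually_all.2 fun s => (h s).eventually_hasWalk hj] with t ht
  exact ht t rfl

lemma eventually_hasWalk_trans (h : ∀ᶠ t in atTop, HasWalk E t i j) (hjk : ReflTransGen E j k) :
    ∀ᶠ t in atTop, HasWalk E t i k := by
  obtain ⟨d, hd⟩ := reflTransGen_iff_exists_hasWalk.1 hjk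
  filter_upwards [(tendsto_sub_atTop_nat d).eventually h, eventually_ge_atTop d] with t ht hdt
  exact Nat.sub_add_cancel hdt ▸ ht.trans hd

lemma eventually_hasWalk_self_of_setGcd_dvd (E : α → α → Prop) (i : α) :
    ∀ᶠ t in atTop, Nat.setGcd {t | HasWalk E t i i} ∣ t → HasWalk E t i i := by
  let closedLengths : AddSubmonoid ℕ :=
    { carrier := {t | HasWalk E t i i}
      zero_mem' := rfl
      add_mem' := HasWalk.trans }
  obtain ⟨T, hT⟩ := Nat.exists_mem_closure_of_ge (closedLengths : Set ℕ)
  rw [AddSubmonoid.closure_eq] at hT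
  filter_upwards [eventually_ge_atTop T] with t ht hdvd using hT t ht hdvd

lemma setGcd_dvd_of_hasWalk {p : ℕ} (hij : ReflTransGen E i j) (hji : ReflTransGen E j i)
    (hj : HasWalk E p j j) : Nat.setGcd {t | HasWalk E t i i} ∣ p := by
  obtain ⟨a, ha⟩ := reflTransGen_iff_exists_hasWalk.1 hij
  obtain ⟨b, hb⟩ := reflTransGen_iff_exists_hasWalk.1 hji
  have hab : a + b ∈ {t | HasWalk E t i i} := ha.trans hb
  have hapb : a + p + b ∈ {t | HasWalk E t i i} := (ha.trans hj).trans hb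
  simpa [show a + p + b - (a + b) = p by omega] using
    Nat.dvd_sub (Nat.setGcd_dvd_of_mem hapb) (Nat.setGcd_dvd_of_mem hab)

end Walks

section Cycles

variable {n : ℕ} {E : Fin n → Fin n → Prop} {i j : Fin n}

lemma SameComp.refl (i : Fin n) : SameComp E i i := ⟨.refl, .refl⟩

lemma SameComp.symm (h : SameComp E i j) : SameComp E j i := ⟨h.2, h.1⟩

lemma SameComp.trans {k : Fin n} (h : SameComp E i j) (h' : SameComp E j k) : SameComp E i k :=
  ⟨h.1.trans h'.1, h'.2.trans h.2⟩

lemma IsCycle.sameComp {k : ℕ} {c : ℕ → Fin n} (h : IsCycle E k c) {t : ℕ} (ht : t ≤ k) :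
    SameComp E (c 0) (c t) := by
  have hto : HasWalk E t (c 0) (c t) := hasWalk_of_forall_edge fun s hs => h.edges s (by omega)
  have hfrom : HasWalk E (k - t) (c t) (c (t + (k - t))) :=
    hasWalk_of_forall_edge (c := fun s => c (t + s)) fun s hs => h.edges (t + s) (by omega)
  rw [Nat.add_sub_cancel' ht, h.closed] at hfrom
  exact ⟨reflTransGen_iff_exists_hasWalk.2 ⟨_, hto⟩, reflTransGen_iff_exists_hasWalk.2 ⟨_, hfrom⟩⟩

lemma isCycle_shift {c : ℕ → Fin n} {a k : ℕ} (hk : 1 ≤ k) (hc : c (a + k) = c a)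
    (hE : ∀ s < k, E (c (a + s)) (c (a + s + 1))) : IsCycle E k fun s => c (a + s) :=
  ⟨hk, hc, hE⟩

lemma onCycle_iff_transGen : OnCycle E i ↔ TransGen E i i := by
  constructor
  · rintro ⟨k, c, hc, t, ht, rfl⟩
    exact ((TransGen.single (hc.edges t ht)).trans_left (hc.sameComp ht).2).trans_left
      (hc.sameComp ht.le).1
  · intro h
    obtain ⟨t, ht⟩ := transGen_iff_exists_hasWalk.1 h
    obtain ⟨c, rfl, hct, hc⟩ := ht.exists_forall_edge
    exact ⟨t + 1, c, ⟨by omega, hct, hc⟩, 0, by omega, rfl⟩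

lemma OnCycle.of_sameComp (hj : OnCycle E j) (h : SameComp E i j) : OnCycle E i :=
  onCycle_iff_transGen.2 (((onCycle_iff_transGen.1 hj).trans_right h.1).trans_left h.2)

lemma OnCycle.exists_succ (h : OnCycle E i) : ∃ j, OnCycle E j ∧ E i j := by
  obtain ⟨j, e, hji⟩ := TransGen.head'_iff.1 (onCycle_iff_transGen.1 h)
  exact ⟨j, onCycle_iff_transGen.2 (TransGen.tail' hji e), e⟩

lemma OnCycle.exists_pred (h : OnCycle E i) : ∃ j, OnCycle E j ∧ E j i := by
  obtain ⟨j, hij, e⟩ := TransGen.tail'_iff.1 (onCycle_iff_transGen.1 h)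
  exact ⟨j, onCycle_iff_transGen.2 (TransGen.head' e hij), e⟩

lemma OnCycle.exists_hasWalk_from (h : OnCycle E i) (t : ℕ) :
    ∃ j, OnCycle E j ∧ HasWalk E t i j := by
  induction t with
  | zero => exact ⟨i, h, rfl⟩
  | succ t ih =>
    obtain ⟨j, hj, hw⟩ := ih
    obtain ⟨k, hk, e⟩ := hj.exists_succ
    exact ⟨k, hk, j, hw, e⟩

lemma OnCycle.exists_hasWalk_to (h : OnCycle E i) (t : ℕ) :
    ∃ j, OnCycle E j ∧ HasWalk E t j i := by
  induction t with
  | zero => exact ⟨i, h, rfl⟩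
  | succ t ih =>
    obtain ⟨j, hj, hw⟩ := ih
    obtain ⟨k, hk, e⟩ := hj.exists_pred
    exact ⟨k, hk, add_comm 1 t ▸ (hasWalk_one e).trans hw⟩

lemma OnCycle.exists_hasWalkMod_from (h : OnCycle E i) {γ : ℕ} [NeZero γ] (s : ZMod γ) :
    ∃ j, OnCycle E j ∧ HasWalkMod E γ s i j :=
  let ⟨j, hj, hw⟩ := h.exists_hasWalk_from s.val; ⟨j, hj, s.val, ZMod.natCast_zmod_val s, hw⟩

lemma OnCycle.exists_hasWalkMod_to (h : OnCycle E i) {γ : ℕ} [NeZero γ] (s : ZMod γ) :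
    ∃ j, OnCycle E j ∧ HasWalkMod E γ s j i :=
  let ⟨j, hj, hw⟩ := h.exists_hasWalk_to s.val; ⟨j, hj, s.val, ZMod.natCast_zmod_val s, hw⟩

lemma IsSimpleCycle.length_le {k : ℕ} {c : ℕ → Fin n} (h : IsSimpleCycle E k c) : k ≤ n := by
  simpa using Finset.card_le_card_of_injOn (s := Finset.range k) (t := Finset.univ) c
    (by simp) (by simpa using h.2)

/-- A shortest cycle in the component is simple. -/
lemma OnCycle.exists_isSimpleCycle (h : OnCycle E i) :
    ∃ k c, IsSimpleCycle E k c ∧ SameComp E (c 0) i := by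
  classical
  have hex : ∃ k c, IsCycle E k c ∧ SameComp E (c 0) i := by
    obtain ⟨k, c, hc, t, ht, rfl⟩ := h
    exact ⟨k, c, hc, hc.sameComp ht.le⟩
  obtain ⟨c, hc, hci⟩ := Nat.find_spec hex
  have hmin (m : ℕ) (hm : m < Nat.find hex) := Nat.find_min hex hm
  generalize Nat.find hex = k at hc hmin
  refine ⟨k, c, ⟨hc, ?_⟩, hci⟩
  have hne : ∀ s t, s < t → t < k → c s ≠ c t := by
    intro s t hst htk heq
    have hshort : IsCycle E (t - s) fun u => c (s + u) :=
      isCycle_shift (by omega) (by rw [Nat.add_sub_cancel' hst.le, heq])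
        fun u hu => hc.edges (s + u) (by omega)
    have hs : s ≤ k := by omega
    exact hmin (t - s) (by omega)
      ⟨_, hshort, (hc.sameComp hs).symm.trans hci⟩
  intro s hs t ht heq
  by_contra hst
  rcases Nat.lt_or_gt_of_ne hst with h | h
  · exact hne s t h ht heq
  · exact hne t s h hs heq.symm

lemma compCyclicity_ne_zero (h : OnCycle E i) : compCyclicity E i ≠ 0 := by
  obtain ⟨k, c, hc, hci⟩ := h.exists_isSimpleCycle
  have hpos := hc.1.pos
  intro h0
  have hk : k = 0 := Finset.gcd_eq_zero_iff.1 h0 k (by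
    simpa [Nat.lt_succ_iff] using ⟨hc.length_le, c, hc, hci⟩)
  omega

instance : NeZero (cyclicity E) := by
  classical
  refine ⟨fun h0 => ?_⟩
  obtain ⟨i, hi, h0⟩ := Finset.lcm_eq_zero_iff.1 h0
  exact compCyclicity_ne_zero (by simpa using hi) h0

lemma OnCycle.eventually_hasWalk_self (h : OnCycle E i) :
    ∀ᶠ t in atTop, cyclicity E ∣ t → HasWalk E t i i := by
  classical
  have hcomp : Nat.setGcd {t | HasWalk E t i i} ∣ compCyclicity E i := by
    refine Finset.dvd_gcd fun k hk => ?_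
    obtain ⟨-, c, hc, hci⟩ := Finset.mem_filter.1 hk
    refine setGcd_dvd_of_hasWalk hci.2 hci.1 ?_
    simpa only [id, hc.1.closed] using hasWalk_of_forall_edge hc.1.edges
  have hdvd : Nat.setGcd {t | HasWalk E t i i} ∣ cyclicity E :=
    hcomp.trans (Finset.dvd_lcm (f := compCyclicity E) (b := i) (by simpa using h))
  exact (eventually_hasWalk_self_of_setGcd_dvd E i).mono fun t ht hγ => ht (hdvd.trans hγ)

lemma OnCycle.frequently_hasWalk_self (h : OnCycle E i) : ∃ᶠ t in atTop, HasWalk E t i i :=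
  ((Nat.frequently_modEq (NeZero.ne (cyclicity E)) 0).and_eventually
    h.eventually_hasWalk_self).mono fun _ ht => ht.2 (Nat.modEq_zero_iff_dvd.1 ht.1)

lemma OnCycle.exists_pred_hasWalkMod_neg_one (h : OnCycle E i) :
    ∃ j, E j i ∧ HasWalkMod E (cyclicity E) (-1) i j := by
  obtain ⟨t, ⟨hmod, hw⟩, ht⟩ := (((Nat.frequently_modEq (NeZero.ne (cyclicity E)) 0).and_eventually
    h.eventually_hasWalk_self).and_eventually (eventually_ge_atTop 1)).exists
  have hdvd := Nat.modEq_zero_iff_dvd.1 hmod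
  obtain ⟨t, rfl⟩ := Nat.exists_eq_add_of_le' ht
  obtain ⟨j, hij, e⟩ := hw hdvd
  refine ⟨j, e, t, eq_neg_of_add_eq_zero_left ?_, hij⟩
  exact_mod_cast (ZMod.natCast_eq_zero_iff _ _).2 hdvd

/-- A node on no cycle inherits a property from its predecessors. -/
lemma induction_on_acyclic {P : Fin n → Prop} (hcycle : ∀ i, OnCycle E i → P i)
    (hpred : ∀ i, (∀ k, E k i → P k) → P i) (i : Fin n) : P i := by
  let R : Fin n → Fin n → Prop := fun k i => E k i ∧ ¬ OnCycle E i
  have hirrefl : Std.Irrefl (TransGen R) := by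
    refine ⟨fun a h => ?_⟩
    obtain ⟨b, -, e⟩ := TransGen.tail'_iff.1 h
    exact e.2 (onCycle_iff_transGen.2 (TransGen.mono (fun _ _ e => e.1) _ _ h))
  induction i using (Finite.wellFounded_of_trans_of_irrefl (TransGen R)).induction with
  | _ i ih =>
    by_cases hi : OnCycle E i
    · exact hcycle i hi
    · exact hpred i fun k hk => ih k (.single ⟨hk, hi⟩)

end Cycles

section Powers

variable {n : ℕ} {A B : Matrix (Fin n) (Fin n) ℝ≥0} {i j : Fin n}

lemma mul_apply_ne_zero : mul A B i j ≠ 0 ↔ ∃ k, A i k ≠ 0 ∧ B k j ≠ 0 := by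
  rw [mul, ← bot_eq_zero, Ne, Finset.sup_eq_bot_iff]
  simp [not_or]

lemma le_mul_apply (i k j : Fin n) : A i k * B k j ≤ mul A B i j :=
  Finset.le_sup (f := fun k => A i k * B k j) (Finset.mem_univ k)

protected lemma mul_assoc (A B C : Matrix (Fin n) (Fin n) ℝ≥0) :
    mul (mul A B) C = mul A (mul B C) := by
  funext i j
  simp only [mul, NNReal.mul_finset_sup, NNReal.finset_sup_mul]
  rw [Finset.sup_comm]
  simp only [mul_assoc]

protected lemma mul_one (A : Matrix (Fin n) (Fin n) ℝ≥0) : mul A 1 = A := by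
  funext i j
  refine le_antisymm (Finset.sup_le fun k _ => ?_) (by simpa using le_mul_apply (B := 1) i j j)
  rcases eq_or_ne k j with rfl | h
  · simp
  · simp [Matrix.one_apply_ne h]

protected lemma one_mul (A : Matrix (Fin n) (Fin n) ℝ≥0) : mul 1 A = A := by
  funext i j
  refine le_antisymm (Finset.sup_le fun k _ => ?_) (by simpa using le_mul_apply (A := 1) i i j)
  rcases eq_or_ne i k with rfl | h
  · simp
  · simp [Matrix.one_apply_ne h]

protected lemma pow_one (A : Matrix (Fin n) (Fin n) ℝ≥0) : pow A 1 = A := MaxAlg.one_mul A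

protected lemma pow_add (A : Matrix (Fin n) (Fin n) ℝ≥0) (s t : ℕ) :
    pow A (s + t) = mul (pow A s) (pow A t) := by
  induction t with
  | zero => simp [pow, MaxAlg.mul_one]
  | succ t ih => rw [← add_assoc, pow, ih, MaxAlg.mul_assoc, pow]

lemma pow_pow (A : Matrix (Fin n) (Fin n) ℝ≥0) (s t : ℕ) : pow (pow A s) t = pow A (t * s) := by
  induction t with
  | zero => simp [pow]
  | succ t ih => rw [Nat.succ_mul, MaxAlg.pow_add A, ← ih, pow]

lemma pow_mul_le (A : Matrix (Fin n) (Fin n) ℝ≥0) (s t : ℕ) (i j k : Fin n) :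
    pow A s i j * pow A t j k ≤ pow A (s + t) i k :=
  MaxAlg.pow_add A s t ▸ le_mul_apply i j k

lemma pow_self_le (A : Matrix (Fin n) (Fin n) ℝ≥0) (s m : ℕ) (i : Fin n) :
    pow A s i i ^ m ≤ pow A (m * s) i i := by
  induction m with
  | zero => simp [pow]
  | succ m ih =>
    rw [pow_succ, Nat.succ_mul]
    exact (mul_le_mul_left ih _).trans (pow_mul_le A _ _ i i i)

lemma pow_ne_zero_iff_hasWalk {t : ℕ} : pow A t i j ≠ 0 ↔ HasWalk (edge A) t i j := by
  induction t generalizing j with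
  | zero => simp [pow, HasWalk, Matrix.one_apply]
  | succ t ih => simp only [pow, mul_apply_ne_zero, HasWalk, ih, edge]

lemma mulVec_unitVec (M : Matrix (Fin n) (Fin n) ℝ≥0) (i x : Fin n) :
    mulVec M (unitVec i) x = M x i := by
  refine le_antisymm (Finset.sup_le fun k _ => ?_) ?_
  · rcases eq_or_ne k i with rfl | h <;> simp [unitVec, *]
  · simpa [unitVec, mulVec] using
      Finset.le_sup (f := fun k => M x k * unitVec i k) (Finset.mem_univ i)

lemma mulVec_sup (M : Matrix (Fin n) (Fin n) ℝ≥0) (y z : Fin n → ℝ≥0) :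
    mulVec M (y ⊔ z) = mulVec M y ⊔ mulVec M z := by
  funext x
  simp only [mulVec, Pi.sup_apply, mul_max]
  exact Finset.sup_sup

lemma weight_add (A : Matrix (Fin n) (Fin n) ℝ≥0) (s t : ℕ) (c : ℕ → Fin n) :
    weight A (s + t) c = weight A s c * weight A t fun u => c (s + u) :=
  Finset.prod_range_add _ s t

lemma weight_le_pow (A : Matrix (Fin n) (Fin n) ℝ≥0) (t : ℕ) (c : ℕ → Fin n) :
    weight A t c ≤ pow A t (c 0) (c t) := by
  induction t with
  | zero => simp [weight, pow]
  | succ t ih =>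
    rw [weight, Finset.prod_range_succ]
    exact (mul_le_mul_left ih _).trans (le_mul_apply _ _ _)

lemma weight_ne_zero_iff {t : ℕ} {c : ℕ → Fin n} :
    weight A t c ≠ 0 ↔ ∀ s < t, edge A (c s) (c (s + 1)) := by
  simp [weight, Finset.prod_eq_zero_iff, edge]

lemma exists_weight_eq_pow {t : ℕ} (h : pow A t i j ≠ 0) :
    ∃ c : ℕ → Fin n, c 0 = i ∧ c t = j ∧ weight A t c = pow A t i j := by
  induction t generalizing j with
  | zero =>
    cases pow_ne_zero_iff_hasWalk.1 h
    exact ⟨fun _ => i, rfl, rfl, by simp [weight, pow]⟩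
  | succ t ih =>
    obtain ⟨k, -, hk : pow A (t + 1) i j = pow A t i k * A k j⟩ :=
      Finset.exists_mem_eq_sup Finset.univ ⟨i, Finset.mem_univ i⟩ fun k => pow A t i k * A k j
    obtain ⟨c, h0, rfl, hc⟩ := ih (left_ne_zero_of_mul (hk ▸ h))
    refine ⟨Function.update c (t + 1) j, by simpa using h0, by simp, ?_⟩
    rw [hk, ← hc, weight, weight, Finset.prod_range_succ]
    congr 1
    · refine Finset.prod_congr rfl fun s hs => ?_
      have hst := Finset.mem_range.1 hs
      rw [Function.update_of_ne (by omega), Function.update_of_ne (by omega)]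
    · simp

end Powers

section CycleMean

variable {n : ℕ} {A : Matrix (Fin n) (Fin n) ℝ≥0} {i : Fin n} {k : ℕ} {c : ℕ → Fin n}

lemma IsCycle.geoMean_pow (h : IsCycle (edge A) k c) : geoMean A k c ^ k = weight A k c := by
  rw [geoMean, one_div, NNReal.rpow_inv_natCast_pow _ (Nat.one_le_iff_ne_zero.1 h.pos)]

lemma IsCycle.geoMean_ne_zero (h : IsCycle (edge A) k c) : geoMean A k c ≠ 0 :=
  fun h0 => weight_ne_zero_iff.2 h.edges <| by
    rw [← h.geoMean_pow, h0, zero_pow (Nat.one_le_iff_ne_zero.1 h.pos)]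

lemma finite_geoMeans (A : Matrix (Fin n) (Fin n) ℝ≥0) :
    {x | ∃ k c, k ≤ n ∧ IsCycle (edge A) k c ∧ x = geoMean A k c}.Finite := by
  refine (Set.finite_range fun p : Fin (n + 1) × (Fin (n + 1) → Fin n) =>
    geoMean A p.1 fun t => p.2 ⟨min t n, by omega⟩).subset ?_
  rintro x ⟨k, c, hk, -, rfl⟩
  refine ⟨⟨⟨k, by omega⟩, fun t => c t⟩, ?_⟩
  simp only [geoMean, weight]
  congr 1
  refine Finset.prod_congr rfl fun t ht => ?_
  have htk := Finset.mem_range.1 ht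
  rw [min_eq_left (by omega), min_eq_left (by omega)]

lemma geoMean_le_mcgm (hk : k ≤ n) (h : IsCycle (edge A) k c) : geoMean A k c ≤ mcgm A :=
  le_csSup (finite_geoMeans A).bddAbove ⟨k, c, hk, h, rfl⟩

lemma weight_le_mcgm_pow (hk : k ≤ n) (h : IsCycle (edge A) k c) :
    weight A k c ≤ mcgm A ^ k :=
  h.geoMean_pow ▸ pow_le_pow_left₀ zero_le (geoMean_le_mcgm hk h) k

lemma exists_critCycle (h : mcgm A ≠ 0) : ∃ k c, k ≤ n ∧ IsCritCycle A k c := by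
  have hne : {x | ∃ k c, k ≤ n ∧ IsCycle (edge A) k c ∧ x = geoMean A k c}.Nonempty := by
    by_contra hne
    exact h (by rw [mcgm, Set.not_nonempty_iff_eq_empty.1 hne]; simp)
  obtain ⟨k, c, hk, hc, hx⟩ := hne.csSup_mem (finite_geoMeans A)
  exact ⟨k, c, hk, hc, hx.symm⟩

lemma OnCycle.mcgm_ne_zero (h : OnCycle (edge A) i) : mcgm A ≠ 0 := by
  obtain ⟨k, c, hc, -⟩ := h.exists_isSimpleCycle
  intro h0
  exact hc.1.geoMean_ne_zero (le_zero_iff.1 (h0 ▸ geoMean_le_mcgm hc.length_le hc.1))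

lemma critNodes_nonempty (h : mcgm A ≠ 0) : (critNodes A).Nonempty := by
  obtain ⟨k, c, -, hc⟩ := exists_critCycle h
  exact ⟨c 0, k, c, hc, 0, hc.1.pos, rfl⟩

lemma frequently_mcgm_pow_le (h : i ∈ critNodes A) :
    ∃ᶠ t in atTop, mcgm A ^ t ≤ pow A t i i := by
  obtain ⟨k, c, hc, t, ht, rfl⟩ := h
  have hk : mcgm A ^ k ≤ pow A k (c t) (c t) := by
    have hfrom := weight_le_pow A (k - t) fun u => c (t + u)
    simp only [Nat.add_sub_cancel' ht.le, hc.1.closed, add_zero] at hfrom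
    calc mcgm A ^ k = weight A (t + (k - t)) c := by
          rw [← hc.2, hc.1.geoMean_pow, Nat.add_sub_cancel' ht.le]
      _ = weight A (k - t) (fun u => c (t + u)) * weight A t c := by
          rw [weight_add, mul_comm]
      _ ≤ pow A (k - t) (c t) (c 0) * pow A t (c 0) (c t) :=
          mul_le_mul' hfrom (weight_le_pow A t c)
      _ ≤ pow A (k - t + t) (c t) (c t) := pow_mul_le A _ _ _ _ _
      _ = pow A k (c t) (c t) := by rw [Nat.sub_add_cancel ht.le]
  refine frequently_atTop.2 fun m => ⟨m * k, Nat.le_mul_of_pos_right m hc.1.pos, ?_⟩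
  calc mcgm A ^ (m * k) = (mcgm A ^ k) ^ m := by rw [← pow_mul, mul_comm]
    _ ≤ pow A k (c t) (c t) ^ m := pow_le_pow_left₀ zero_le hk m
    _ ≤ pow A (m * k) (c t) (c t) := pow_self_le A k m (c t)

lemma exists_repeat (c : ℕ → Fin n) : ∃ a b, a < b ∧ b ≤ n ∧ c a = c b := by
  obtain ⟨x, y, hxy, he⟩ := Fintype.exists_ne_map_eq_of_card_lt
    (fun s : Fin (n + 1) => c s) (by simp)
  rcases lt_or_gt_of_ne hxy with h | h
  · exact ⟨x, y, h, by omega, he⟩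
  · exact ⟨y, x, h, by omega, he.symm⟩

/-- Remove a cycle from a walk of maximal weight. -/
lemma exists_pow_le_pow_mul_mcgm_pow {t : ℕ} (ht : n ≤ t) (i j : Fin n) :
    ∃ s < t, pow A t i j ≤ pow A s i j * mcgm A ^ (t - s) := by
  by_cases h0 : pow A t i j = 0
  · exact ⟨0, i.pos.trans_le ht, h0 ▸ zero_le⟩
  obtain ⟨c, rfl, rfl, hc⟩ := exists_weight_eq_pow h0
  have hedge := weight_ne_zero_iff.1 (hc ▸ h0)
  obtain ⟨a, b, hab, hbn, heq⟩ := exists_repeat c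
  obtain ⟨p, rfl⟩ := Nat.exists_eq_add_of_le hab.le
  obtain ⟨q, rfl⟩ := Nat.exists_eq_add_of_le (hbn.trans ht)
  have hcycle : IsCycle (edge A) p fun u => c (a + u) :=
    isCycle_shift (by omega) heq.symm fun s _ => hedge (a + s) (by omega)
  have htail := weight_le_pow A q fun u => c (a + p + u)
  simp only [add_zero, ← heq] at htail
  refine ⟨a + q, by omega, ?_⟩
  calc pow A (a + p + q) (c 0) (c (a + p + q))
      = weight A a c * weight A q (fun u => c (a + p + u)) * weight A p fun u => c (a + u) := by
        rw [← hc, weight_add, weight_add, mul_right_comm]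
    _ ≤ pow A a (c 0) (c a) * pow A q (c a) (c (a + p + q)) * mcgm A ^ p :=
        mul_le_mul' (mul_le_mul' (weight_le_pow A a c) htail)
          (weight_le_mcgm_pow (by omega) hcycle)
    _ ≤ pow A (a + q) (c 0) (c (a + p + q)) * mcgm A ^ p := by
        gcongr; exact pow_mul_le A _ _ _ _ _
    _ = _ := by congr 2; omega

lemma exists_pow_le (h : mcgm A ≠ 0) : ∃ C, ∀ t i j, pow A t i j ≤ C * mcgm A ^ t := by
  obtain ⟨C, hC⟩ := (Set.finite_range fun p : Fin n × Fin n × Fin n =>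
    pow A p.1 p.2.1 p.2.2 / mcgm A ^ (p.1 : ℕ)).bddAbove
  refine ⟨C, fun t => ?_⟩
  induction t using Nat.strong_induction_on with
  | _ t ih =>
    intro i j
    rcases lt_or_ge t n with ht | ht
    · rw [← div_le_iff₀ (pow_pos (pos_iff_ne_zero.2 h) t)]
      exact hC ⟨(⟨t, ht⟩, i, j), rfl⟩
    · obtain ⟨s, hst, hle⟩ := exists_pow_le_pow_mul_mcgm_pow (A := A) ht i j
      calc pow A t i j ≤ pow A s i j * mcgm A ^ (t - s) := hle
        _ ≤ C * mcgm A ^ s * mcgm A ^ (t - s) := by gcongr; exact ih s hst i j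
        _ = C * mcgm A ^ t := by rw [mul_assoc, ← pow_add, Nat.add_sub_cancel' hst.le]

end CycleMean

section CSR

variable {n : ℕ} {A : Matrix (Fin n) (Fin n) ℝ≥0} {i j k : Fin n}

lemma critEdge.edge (h : critEdge A i j) : edge A i j := by
  obtain ⟨k, c, hc, t, ht, rfl, rfl⟩ := h
  exact hc.1.edges t ht

lemma mem_critNodes_iff_onCycle : i ∈ critNodes A ↔ OnCycle (critEdge A) i := by
  constructor
  · rintro ⟨k, c, hc, t, ht, rfl⟩
    exact ⟨k, c, ⟨hc.1.pos, hc.1.closed, fun s hs => ⟨k, c, hc, s, hs, rfl, rfl⟩⟩, t, ht, rfl⟩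
  · intro h
    obtain ⟨-, -, k, c, hc, t, ht, hi, -⟩ := h.exists_succ
    exact ⟨k, c, hc, t, ht, hi⟩

lemma critEdge.left_mem (h : critEdge A i j) : i ∈ critNodes A :=
  let ⟨k, c, hc, t, ht, hi, _⟩ := h; ⟨k, c, hc, t, ht, hi⟩

lemma onCycle_edge_of_mem_critNodes (h : i ∈ critNodes A) : OnCycle (edge A) i :=
  let ⟨k, c, hc, ht⟩ := h; ⟨k, c, hc.1, ht⟩

lemma pow_normalize (A : Matrix (Fin n) (Fin n) ℝ≥0) (t : ℕ) (i j : Fin n) :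
    pow (normalize A) t i j = pow A t i j / mcgm A ^ t := by
  induction t generalizing j with
  | zero => simp [pow]
  | succ t ih =>
    simp only [pow, mul, ih, normalize, div_mul_div_comm, ← pow_succ, NNReal.finset_sup_div]

lemma kleeneStar_ne_zero_iff (h : BddAbove (Set.range fun t => pow A t i j)) :
    kleeneStar A i j ≠ 0 ↔ ∃ t, pow A t i j ≠ 0 := by
  simp only [← pos_iff_ne_zero, kleeneStar, lt_ciSup_iff h]

lemma starB_ne_zero_iff (h : mcgm A ≠ 0) :
    starB A i j ≠ 0 ↔ HasWalkMod (edge A) (cyclicity (critEdge A)) 0 i j := by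
  have hpow (m : ℕ) : pow (pow (normalize A) (cyclicity (critEdge A))) m i j
      = pow A (m * cyclicity (critEdge A)) i j / mcgm A ^ (m * cyclicity (critEdge A)) := by
    rw [pow_pow, pow_normalize]
  obtain ⟨C, hC⟩ := exists_pow_le h
  have hbdd : BddAbove (Set.range fun m =>
      pow (pow (normalize A) (cyclicity (critEdge A))) m i j) := by
    refine ⟨C, ?_⟩
    rintro _ ⟨m, rfl⟩
    simpa only [hpow] using (div_le_iff₀ (pow_pos (pos_iff_ne_zero.2 h) _)).2 (hC _ _ _)
  simp only [starB, kleeneStar_ne_zero_iff hbdd, hpow, div_ne_zero_iff, pow_ne_zero_iff_hasWalk,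
    hasWalkMod_zero_iff, pow_ne_zero _ h, ne_eq, not_false_eq_true, and_true]

lemma csr_one_ne_zero_iff (hk : k ∈ critNodes A) :
    csr A 1 j k ≠ 0 ↔ HasWalkMod (edge A) (cyclicity (critEdge A)) 1 j k := by
  have h : mcgm A ≠ 0 := (onCycle_edge_of_mem_critNodes hk).mcgm_ne_zero
  simp only [csr, mul_apply_ne_zero, MaxAlg.pow_one, matC, matR, matS, ite_ne_right_iff,
    starB_ne_zero_iff h]
  constructor
  · rintro ⟨b, ⟨a, ⟨-, hC⟩, hS, -⟩, -, hR⟩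
    simpa using (hC.trans (hasWalkMod_one hS.edge)).trans hR
  · intro hw
    obtain ⟨p, e, hp⟩ := (mem_critNodes_iff_onCycle.1 hk).exists_pred_hasWalkMod_neg_one
    have hjp := hw.trans (hp.mono fun _ _ => critEdge.edge)
    rw [add_neg_cancel] at hjp
    exact ⟨k, ⟨p, ⟨e.left_mem, hjp⟩, e, div_ne_zero e.edge h⟩, hk, 0, Nat.cast_zero, rfl⟩

end CSR

section UltimateExpansion

variable {n : ℕ} {A : Matrix (Fin n) (Fin n) ℝ≥0} {K : Set (Fin n)} {i j : Fin n} {μ ν : ℕ}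

lemma edge_restrict : edge (restrict A K) i j ↔ (i ∈ K ∧ j ∈ K) ∧ edge A i j := by
  simp [edge, restrict, and_assoc]

lemma isCycle_restrict_iff {k : ℕ} {c : ℕ → Fin n} :
    IsCycle (edge (restrict A K)) k c ↔ IsCycle (edge A) k c ∧ ∀ t ≤ k, c t ∈ K := by
  constructor
  · intro h
    have hmem : ∀ t < k, c t ∈ K := fun t ht => (edge_restrict.1 (h.edges t ht)).1.1
    refine ⟨⟨h.pos, h.closed, fun t ht => (edge_restrict.1 (h.edges t ht)).2⟩, fun t ht => ?_⟩
    rcases ht.lt_or_eq with ht | rfl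
    · exact hmem t ht
    · exact h.closed ▸ hmem 0 h.pos
  · rintro ⟨h, hK⟩
    exact ⟨h.pos, h.closed, fun t ht =>
      edge_restrict.2 ⟨⟨hK t ht.le, hK (t + 1) ht⟩, h.edges t ht⟩⟩

lemma geoMean_restrict {k : ℕ} {c : ℕ → Fin n} (h : ∀ t ≤ k, c t ∈ K) :
    geoMean (restrict A K) k c = geoMean A k c := by
  rw [geoMean, geoMean, weight, weight]
  congr 1
  refine Finset.prod_congr rfl fun t ht => ?_
  have htk := Finset.mem_range.1 ht
  rw [restrict, if_pos ⟨h t htk.le, h (t + 1) htk⟩]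

lemma critNodes_restrict_subset : critNodes (restrict A K) ⊆ K := by
  rintro _ ⟨k, c, hc, t, ht, rfl⟩
  exact (isCycle_restrict_iff.1 hc.1).2 t ht.le

lemma critNodes_subset_hitNodes : critNodes (restrict A K) ⊆ hitNodes A K :=
  fun i hi => ⟨i, hi, .refl i⟩

lemma pow_restrict_eq
    (hK : ∀ k, ReflTransGen (edge A) i k → ReflTransGen (edge A) k j → k ∈ K) (t : ℕ) :
    pow (restrict A K) t i j = pow A t i j := by
  induction t generalizing j with
  | zero => rfl
  | succ t ih =>
    simp only [pow, mul]
    refine Finset.sup_congr rfl fun k _ => ?_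
    by_cases hkj : A k j = 0
    · simp [restrict, hkj]
    have hk : pow (restrict A K) t i k = pow A t i k :=
      ih fun l hil hlk => hK l hil (hlk.tail hkj)
    by_cases hik : pow A t i k = 0
    · rw [hk, hik, zero_mul, zero_mul]
    have hwalk : ReflTransGen (edge A) i k :=
      reflTransGen_iff_exists_hasWalk.2 ⟨t, pow_ne_zero_iff_hasWalk.1 hik⟩
    rw [hk, restrict, if_pos ⟨hK k hwalk (.single hkj), hK j (hwalk.tail hkj) .refl⟩]

lemma mem_ultK_of_sameComp (h : SameComp (edge A) i j) (hi : i ∈ ultK A μ) : j ∈ ultK A μ := by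
  induction μ with
  | zero => trivial
  | succ μ ih => exact ⟨ih hi.1, fun ⟨k, hk, hjk⟩ => hi.2 ⟨k, hk, h.trans hjk⟩⟩

lemma ultK_antitone (A : Matrix (Fin n) (Fin n) ℝ≥0) : Antitone (ultK A) :=
  antitone_nat_of_succ_le fun _ => Set.sdiff_subset

lemma exists_hit_of_notMem_ultK (h : i ∉ ultK A μ) :
    ∃ ν < μ, ∃ j ∈ ultN A ν, SameComp (edge A) i j := by
  induction μ with
  | zero => exact absurd trivial h
  | succ μ ih =>
    by_cases hi : i ∈ ultK A μ
    · exact ⟨μ, μ.lt_succ_self, not_not.1 fun hhit => h ⟨hi, hhit⟩⟩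
    · obtain ⟨ν, hν, hhit⟩ := ih hi
      exact ⟨ν, by omega, hhit⟩

lemma onCycle_of_mem_ultN (h : i ∈ ultN A μ) : OnCycle (edge A) i :=
  let ⟨k, c, hc, ht⟩ := h; ⟨k, c, (isCycle_restrict_iff.1 hc.1).1, ht⟩

lemma mem_ultIndex_of_mem_ultN (h : i ∈ ultN A μ) : μ ∈ ultIndex A :=
  (onCycle_edge_of_mem_critNodes h).mcgm_ne_zero

lemma ultLam_lt (hνμ : ν < μ) (hμ : ultLam A μ ≠ 0) : ultLam A μ < ultLam A ν := by
  obtain ⟨k, c, hk, hc, hgeo⟩ := exists_critCycle hμ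
  obtain ⟨hcA, hmem⟩ := isCycle_restrict_iff.1 hc
  have hmem' : ∀ t ≤ k, c t ∈ ultK A ν := fun t ht => ultK_antitone A hνμ.le (hmem t ht)
  have hcν : IsCycle (edge (ultA A ν)) k c := isCycle_restrict_iff.2 ⟨hcA, hmem'⟩
  have heq : geoMean (ultA A ν) k c = ultLam A μ :=
    (geoMean_restrict hmem').trans ((geoMean_restrict hmem).symm.trans hgeo)
  refine (heq ▸ geoMean_le_mcgm hk hcν).lt_of_ne fun h => ?_
  have hcrit : c 0 ∈ critNodes (ultA A ν) := ⟨k, c, ⟨hcν, heq.trans h⟩, 0, hc.pos, rfl⟩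
  have hleft : c 0 ∈ ultK A (ν + 1) := ultK_antitone A hνμ (hmem 0 k.zero_le)
  exact hleft.2 (critNodes_subset_hitNodes hcrit)

lemma ncard_ultK_add_le (hμ : ultLam A μ ≠ 0) : (ultK A μ).ncard + μ ≤ n := by
  induction μ with
  | zero => simp [ultK]
  | succ μ ih =>
    have hlam : ultLam A μ ≠ 0 := (zero_le.trans_lt (ultLam_lt μ.lt_succ_self hμ)).ne'
    obtain ⟨i, hi⟩ := critNodes_nonempty hlam
    have hlt : (ultK A (μ + 1)).ncard < (ultK A μ).ncard :=
      Set.ncard_lt_ncard ⟨Set.sdiff_subset, fun h =>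
        (h (critNodes_restrict_subset hi)).2 (critNodes_subset_hitNodes hi)⟩
    have hle := ih hlam
    omega

lemma lt_of_mem_ultIndex (hμ : μ ∈ ultIndex A) : μ < n := by
  obtain ⟨i, hi⟩ := critNodes_nonempty hμ
  have hpos : 0 < (ultK A μ).ncard := (Set.ncard_pos).2 ⟨i, critNodes_restrict_subset hi⟩
  have hle := ncard_ultK_add_le hμ
  omega

instance : NeZero (ultCyclicity A) := by
  classical
  refine ⟨fun h0 => ?_⟩
  obtain ⟨μ, -, hμ⟩ := Finset.lcm_eq_zero_iff.1 h0
  exact NeZero.ne _ hμ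

lemma cyclicity_dvd_ultCyclicity (hμ : μ ∈ ultIndex A) :
    cyclicity (critEdge (ultA A μ)) ∣ ultCyclicity A :=
  Finset.dvd_lcm (f := fun μ => cyclicity (critEdge (ultA A μ)))
    (by simpa using ⟨lt_of_mem_ultIndex hμ, hμ⟩)

lemma OnCycle.exists_hit (h : OnCycle (edge A) i) :
    ∃ μ, ∃ j ∈ ultN A μ, SameComp (edge A) i j := by
  by_contra! hno
  have hi : i ∈ ultK A n := by
    by_contra hi
    obtain ⟨ν, -, j, hj, hij⟩ := exists_hit_of_notMem_ultK hi
    exact hno ν j hj hij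
  obtain ⟨k, c, hc, t, ht, rfl⟩ := h
  have hcycle : IsCycle (edge (ultA A n)) k c := isCycle_restrict_iff.2 ⟨hc, fun s hs =>
    mem_ultK_of_sameComp ((hc.sameComp ht.le).symm.trans (hc.sameComp hs)) hi⟩
  have hlam : n ∈ ultIndex A := OnCycle.mcgm_ne_zero ⟨k, c, hcycle, t, ht, rfl⟩
  exact lt_irrefl n (lt_of_mem_ultIndex hlam)

lemma edge_of_critEdge_ultA (h : critEdge (ultA A μ) i j) : edge A i j :=
  (edge_restrict.1 h.edge).2

lemma eventually_hasWalk_self_of_mem_ultN (h : i ∈ ultN A μ) :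
    ∀ᶠ t in atTop, cyclicity (critEdge (ultA A μ)) ∣ t → HasWalk (edge A) t i i :=
  (mem_critNodes_iff_onCycle.1 h).eventually_hasWalk_self.mono fun _ ht hγ =>
    (ht hγ).mono fun _ _ => edge_of_critEdge_ultA

end UltimateExpansion

section Rates

variable {n : ℕ} {A : Matrix (Fin n) (Fin n) ℝ≥0} {g : ℕ} {r : Fin n → ℝ≥0} {i j k x : Fin n}
  {μ ν : ℕ}

/-- For every node `i` on a cycle the orbit `A ^ t ⊗ e_i` is ultimately linear periodic with
period `g` and growth rate `r i`. The values of `r` at the other nodes are irrelevant. -/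
def HasRates (A : Matrix (Fin n) (Fin n) ℝ≥0) (g : ℕ) (r : Fin n → ℝ≥0) : Prop :=
  ∀ i, OnCycle (edge A) i → ∀ x, UltGeometric g (r i) fun t => pow A t x i

namespace HasRates

variable [NeZero g]

lemma mono (hr : HasRates A g r) (hi : OnCycle (edge A) i) (hj : OnCycle (edge A) j)
    (hji : ReflTransGen (edge A) j i) : r j ≤ r i := by
  obtain ⟨d, hd⟩ := reflTransGen_iff_exists_hasWalk.1 hji
  refine ((hr j hj j).const_mul (pow A d j i)).rate_le ((UltGeometric.comp_add_iff d).2 (hr i hi j))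
    (hj.frequently_hasWalk_self.mono fun t ht => ⟨?_, ?_⟩)
  · exact mul_ne_zero (pow_ne_zero_iff_hasWalk.2 hd) (pow_ne_zero_iff_hasWalk.2 ht)
  · rw [mul_comm]
    exact pow_mul_le A t d j j i

lemma eq_ultLam (hr : HasRates A g r) (hk : k ∈ ultN A μ) : r k = ultLam A μ := by
  have hlam : ultLam A μ ≠ 0 := mem_ultIndex_of_mem_ultN hk
  have hgeo := hr k (onCycle_of_mem_ultN hk) k
  have hpow (t : ℕ) : pow (ultA A μ) t k k = pow A t k k :=
    pow_restrict_eq (fun _ hto hfrom =>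
      mem_ultK_of_sameComp ⟨hto, hfrom⟩ (critNodes_restrict_subset hk)) t
  have hlow : ∃ᶠ t in atTop, ultLam A μ ^ t ≤ pow A t k k := by
    simpa only [← hpow, ultLam] using frequently_mcgm_pow_le hk
  obtain ⟨C, hC⟩ := exists_pow_le hlam
  apply le_antisymm
  · refine hgeo.rate_le (UltGeometric.pow_self.const_mul C) (hlow.mono fun t ht => ⟨?_, ?_⟩)
    · exact ((pow_pos (pos_iff_ne_zero.2 hlam) t).trans_le ht).ne'
    · exact hpow t ▸ hC t k k
  · exact UltGeometric.pow_self.rate_le hgeo (hlow.mono fun t ht => ⟨pow_ne_zero t hlam, ht⟩)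

lemma eq_ultLam_of_sameComp (hr : HasRates A g r) (hk : k ∈ ultN A μ)
    (hik : SameComp (edge A) i k) : r i = ultLam A μ := by
  have hck := onCycle_of_mem_ultN hk
  have hci := hck.of_sameComp hik
  rw [← hr.eq_ultLam hk]
  exact le_antisymm (hr.mono hck hci hik.1) (hr.mono hci hck hik.2)

lemma mem_ultK_of_reflTransGen (hr : HasRates A g r) (hk : k ∈ ultN A μ)
    (hxk : ReflTransGen (edge A) x k) : x ∈ ultK A μ := by
  by_contra hx
  obtain ⟨ν, hν, j, hj, hxj⟩ := exists_hit_of_notMem_ultK hx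
  have hle : ultLam A ν ≤ ultLam A μ := by
    rw [← hr.eq_ultLam hj, ← hr.eq_ultLam hk]
    exact hr.mono (onCycle_of_mem_ultN hk) (onCycle_of_mem_ultN hj) (hxj.2.trans hxk)
  exact (ultLam_lt hν (mem_ultIndex_of_mem_ultN hk)).not_ge hle

/-- Since growth rates increase along walks, no walk to `N_μ` meets a component removed before
step `μ`. -/
lemma mem_supp_ultTerm_iff (hr : HasRates A g r) (hk : k ∈ ultN A μ) :
    x ∈ supp (mulVec (ultTerm A μ 1) (unitVec k)) ↔
      HasWalkMod (edge A) (cyclicity (critEdge (ultA A μ))) 1 x k := by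
  have hwalk (t : ℕ) : HasWalk (edge (ultA A μ)) t x k ↔ HasWalk (edge A) t x k := by
    rw [← pow_ne_zero_iff_hasWalk, ← pow_ne_zero_iff_hasWalk, ultA,
      pow_restrict_eq fun y _ hyk => hr.mem_ultK_of_reflTransGen hk hyk]
  rw [supp, Set.mem_ofPred_eq, mulVec_unitVec, ultTerm, csr_one_ne_zero_iff hk]
  simp only [HasWalkMod, hwalk]

lemma eventually_pow_ne_zero (hr : HasRates A g r) (hi : OnCycle (edge A) i)
    (hj : OnCycle (edge A) j) (hlt : r i < r j) {s : ℝ≥0}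
    (hs : ∀ x, UltGeometric g s fun t => pow A t x i ⊔ pow A t x j) (x : Fin n) :
    ∀ᶠ t in atTop, pow A t x i ≠ 0 → pow A t x j ≠ 0 := by
  have hjs : r j ≤ s := (hr j hj j).rate_le (hs j) <|
    hj.frequently_hasWalk_self.mono fun t ht => ⟨pow_ne_zero_iff_hasWalk.2 ht, le_sup_right⟩
  by_contra h
  have hsi : s ≤ r i := (hs x).rate_le (hr i hi x) <| (not_eventually.1 h).mono fun t ht => by
    obtain ⟨hxi, hxj⟩ := Classical.not_imp.1 ht
    simpa [not_not.1 hxj] using hxi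
  exact hlt.not_ge (hjs.trans hsi)

end HasRates

end Rates

section Tame

variable {n : ℕ} {A : Matrix (Fin n) (Fin n) ℝ≥0} {g : ℕ} {r : Fin n → ℝ≥0} {ρ σ : ℝ≥0}
  {f f' : ℕ → Fin n → ℝ≥0}

/-- The nodes with access to a node on a cycle whose rate is in `S`. -/
def access (A : Matrix (Fin n) (Fin n) ℝ≥0) (r : Fin n → ℝ≥0) (S : Set ℝ≥0) : Set (Fin n) :=
  {x | ∃ k, OnCycle (edge A) k ∧ r k ∈ S ∧ ReflTransGen (edge A) x k}

/-- A sequence of vectors which is ultimately linear periodic with rate `ρ` and whose ultimate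
supports lie between the set of nodes with access to a smaller rate and the set of nodes with
access to a rate at most `ρ`. Sequences with this property can be added in max algebra: the one
with the larger rate eventually dominates the other one in all coordinates. -/
structure Tame (A : Matrix (Fin n) (Fin n) ℝ≥0) (g : ℕ) (r : Fin n → ℝ≥0) (ρ : ℝ≥0)
    (f : ℕ → Fin n → ℝ≥0) : Prop where
  geometric : ∀ x, UltGeometric g ρ fun t => f t x
  supp_subset : ∀ᶠ t in atTop, supp (f t) ⊆ access A r (Set.Iic ρ)
  subset_supp : ∀ᶠ t in atTop, access A r (Set.Iio ρ) ⊆ supp (f t)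

lemma access_mono {S T : Set ℝ≥0} (h : S ⊆ T) : access A r S ⊆ access A r T :=
  fun _ ⟨k, hk, hS, hxk⟩ => ⟨k, hk, h hS, hxk⟩

namespace Tame

lemma zero : Tame A g r 0 0 where
  geometric _ := .zero
  supp_subset := .of_forall fun _ _ hx => absurd rfl hx
  subset_supp := .of_forall fun _ _ ⟨_, _, hk, _⟩ => absurd (Set.mem_Iio.1 hk) not_lt_zero

lemma congr (hf : Tame A g r ρ f) (h : f =ᶠ[atTop] f') : Tame A g r ρ f' where
  geometric x := (hf.geometric x).congr (h.mono fun _ ht => congrFun ht x)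
  supp_subset := by filter_upwards [hf.supp_subset, h] with t ht heq using heq ▸ ht
  subset_supp := by filter_upwards [hf.subset_supp, h] with t ht heq using heq ▸ ht

lemma smul (hf : Tame A g r ρ f) {c : ℝ≥0} (hc : c ≠ 0) : Tame A g r ρ (c • f) where
  geometric x := (hf.geometric x).const_mul c
  supp_subset := hf.supp_subset.mono fun _ ht _ hx => ht (right_ne_zero_of_mul hx)
  subset_supp := hf.subset_supp.mono fun _ ht _ hx => mul_ne_zero hc (ht hx)

lemma sup (hf : Tame A g r ρ f) (hf' : Tame A g r ρ f') : Tame A g r ρ (f ⊔ f') where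
  geometric x := (hf.geometric x).sup (hf'.geometric x)
  supp_subset := by
    filter_upwards [hf.supp_subset, hf'.supp_subset] with t ht ht' x hx
    by_cases h0 : f t x = 0
    · exact ht' (by simpa [supp, h0] using hx)
    · exact ht h0
  subset_supp := hf.subset_supp.mono fun t ht x hx =>
    ((pos_iff_ne_zero.2 (ht hx)).trans_le (le_sup_left (b := f' t x))).ne'

lemma of_succ (hf : Tame A g r ρ fun t => f (t + 1)) : Tame A g r ρ f where
  geometric x := (UltGeometric.comp_add_iff 1).1 (hf.geometric x)
  supp_subset := by
    rw [← map_add_atTop_eq_nat 1]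
    exact hf.supp_subset
  subset_supp := by
    rw [← map_add_atTop_eq_nat 1]
    exact hf.subset_supp

variable [NeZero g]

lemma eventually_le (hf : Tame A g r ρ f) (hf' : Tame A g r σ f') (h : ρ < σ) :
    ∀ᶠ t in atTop, f t ≤ f' t := by
  have hlt : ∀ᶠ t in atTop, ∀ x, f' t x ≠ 0 → f t x < f' t x :=
    eventually_all.2 fun x => (hf.geometric x).eventually_lt (hf'.geometric x) h
  filter_upwards [hf.supp_subset, hf'.subset_supp, hlt] with t hsub hsub' hlt x
  by_cases h0 : f t x = 0
  · exact h0 ▸ zero_le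
  · exact (hlt x (hsub' (access_mono (Set.Iic_subset_Iio.2 h) (hsub h0)))).le

lemma exists_sup (hf : ∃ ρ, Tame A g r ρ f) (hf' : ∃ ρ, Tame A g r ρ f') :
    ∃ ρ, Tame A g r ρ (f ⊔ f') := by
  obtain ⟨ρ, hf⟩ := hf
  obtain ⟨σ, hf'⟩ := hf'
  rcases lt_trichotomy ρ σ with h | rfl | h
  · exact ⟨σ, hf'.congr ((hf.eventually_le hf' h).mono fun _ ht => (sup_eq_right.2 ht).symm)⟩
  · exact ⟨ρ, hf.sup hf'⟩
  · exact ⟨ρ, hf.congr ((hf'.eventually_le hf h).mono fun _ ht => (sup_eq_left.2 ht).symm)⟩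

lemma exists_finset_sup {ι : Type*} (s : Finset ι) (c : ι → ℝ≥0) {F : ι → ℕ → Fin n → ℝ≥0}
    (h : ∀ i, c i ≠ 0 → ∃ ρ, Tame A g r ρ (F i)) :
    ∃ ρ, Tame A g r ρ (s.sup fun i => c i • F i) := by
  refine Finset.sup_induction (p := fun f => ∃ ρ, Tame A g r ρ f) ⟨0, zero⟩
    (fun _ hf _ hf' => exists_sup hf hf') fun i _ => ?_
  by_cases hc : c i = 0
  · exact ⟨0, by simpa [hc] using zero⟩
  · exact (h i hc).imp fun _ hρ => hρ.smul hc

end Tame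

lemma exists_tame_pow [NeZero g] (hr : HasRates A g r)
    (hacc : ∀ l, OnCycle (edge A) l → ∀ x ∈ access A r (Set.Iio (r l)),
      ∀ᶠ t in atTop, HasWalk (edge A) t x l) (i : Fin n) :
    ∃ ρ, Tame A g r ρ fun t x => pow A t x i := by
  induction i using induction_on_acyclic (E := edge A) with
  | hcycle l hl =>
    refine ⟨r l, hr l hl, .of_forall fun t x hx => ⟨l, hl, Set.self_mem_Iic, ?_⟩, ?_⟩
    · exact reflTransGen_iff_exists_hasWalk.2 ⟨t, pow_ne_zero_iff_hasWalk.1 hx⟩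
    · filter_upwards [eventually_all.2 fun x => eventually_imp_distrib_left.2 (hacc l hl x)]
        with t ht x hx using pow_ne_zero_iff_hasWalk.2 (ht x hx)
  | hpred i ih =>
    obtain ⟨ρ, hρ⟩ := Tame.exists_finset_sup Finset.univ (fun k => A k i) ih
    refine ⟨ρ, Tame.of_succ (hρ.congr (.of_eq ?_))⟩
    funext t x
    simp only [Finset.sup_apply, Pi.smul_apply, smul_eq_mul, pow, mul, mul_comm]

lemma exists_tame_orbit [NeZero g] (hr : HasRates A g r)
    (hacc : ∀ l, OnCycle (edge A) l → ∀ x ∈ access A r (Set.Iio (r l)),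
      ∀ᶠ t in atTop, HasWalk (edge A) t x l) (y : Fin n → ℝ≥0) :
    ∃ ρ, Tame A g r ρ fun t => mulVec (pow A t) y := by
  obtain ⟨ρ, hρ⟩ := Tame.exists_finset_sup Finset.univ y fun k _ => exists_tame_pow hr hacc k
  refine ⟨ρ, hρ.congr (.of_eq ?_)⟩
  funext t x
  simp only [Finset.sup_apply, Pi.smul_apply, smul_eq_mul, mulVec, mul_comm]

end Tame

section OrbitPeriodicity

variable {n : ℕ} {A : Matrix (Fin n) (Fin n) ℝ≥0} {g : ℕ} {r : Fin n → ℝ≥0} {i j k l x : Fin n}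
  {μ ν : ℕ}

lemma ultLinPeriodic_iff {y : Fin n → ℝ≥0} : UltLinPeriodic A y ↔
    ∃ s, ∀ x, UltGeometric (ultCyclicity A) s fun t => mulVec (pow A t) y x := by
  simp only [UltGeometric, ← eventually_all]
  simp only [UltLinPeriodic, eventually_atTop]

lemma exists_hasRates (h : ∀ i, OnCycle (edge A) i → UltLinPeriodic A (unitVec i)) :
    ∃ r, HasRates A (ultCyclicity A) r := by
  have hrate (i : Fin n) : ∃ s, OnCycle (edge A) i →
      ∀ x, UltGeometric (ultCyclicity A) s fun t => pow A t x i := by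
    by_cases hi : OnCycle (edge A) i
    · obtain ⟨s, hs⟩ := ultLinPeriodic_iff.1 (h i hi)
      exact ⟨s, fun _ x => by simpa only [mulVec_unitVec] using hs x⟩
    · exact ⟨0, fun hi' => absurd hi' hi⟩
  exact Classical.skolem.1 hrate

lemma OrbitPeriodic.supp_ultTerm_subset (h : OrbitPeriodic A)
    (hr : HasRates A (ultCyclicity A) r) (hlt : ultLam A μ < ultLam A ν) (hi : i ∈ ultN A μ)
    (hj : j ∈ ultN A ν) :
    supp (mulVec (ultTerm A μ 1) (unitVec i)) ⊆ supp (mulVec (ultTerm A ν 1) (unitVec j)) := by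
  intro x hx
  rw [hr.mem_supp_ultTerm_iff hi] at hx
  rw [hr.mem_supp_ultTerm_iff hj]
  rw [← hr.eq_ultLam hi, ← hr.eq_ultLam hj] at hlt
  obtain ⟨s, hs⟩ := ultLinPeriodic_iff.1 (h (unitVec i ⊔ unitVec j))
  simp only [mulVec_sup, Pi.sup_apply, mulVec_unitVec] at hs
  have hsub := hr.eventually_pow_ne_zero (onCycle_of_mem_ultN hi) (onCycle_of_mem_ultN hj) hlt hs x
  have hwalk := hx.eventually_hasWalk (eventually_hasWalk_self_of_mem_ultN hi)
  have hmod := Nat.frequently_modEq (NeZero.ne (ultCyclicity A)) 1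
  obtain ⟨t, ht, htsub, htwalk⟩ := (hmod.and_eventually (hsub.and hwalk)).exists
  have hcast {κ : ℕ} (hκ : κ ∈ ultIndex A) : (t : ZMod (cyclicity (critEdge (ultA A κ)))) = 1 := by
    exact_mod_cast
      (ZMod.natCast_eq_natCast_iff _ _ _).2 (ht.of_dvd (cyclicity_dvd_ultCyclicity hκ))
  refine ⟨t, hcast (mem_ultIndex_of_mem_ultN hj), pow_ne_zero_iff_hasWalk.1 (htsub ?_)⟩
  exact pow_ne_zero_iff_hasWalk.2 (htwalk (hcast (mem_ultIndex_of_mem_ultN hi)))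

variable [NeZero g]

lemma HasRates.exists_mem_supp_ultTerm (hr : HasRates A g r) (hk : k ∈ ultN A μ)
    (hxk : ReflTransGen (edge A) x k) :
    ∃ i ∈ ultN A μ, x ∈ supp (mulVec (ultTerm A μ 1) (unitVec i)) := by
  obtain ⟨t, ht⟩ := reflTransGen_iff_exists_hasWalk.1 hxk
  obtain ⟨i, hi, hki⟩ := (mem_critNodes_iff_onCycle.1 hk).exists_hasWalkMod_from
    (1 - t : ZMod (cyclicity (critEdge (ultA A μ))))
  have hi : i ∈ ultN A μ := mem_critNodes_iff_onCycle.2 hi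
  refine ⟨i, hi, (hr.mem_supp_ultTerm_iff hi).2 ?_⟩
  simpa using HasWalkMod.trans ⟨t, rfl, ht⟩ (hki.mono fun _ _ => edge_of_critEdge_ultA)

lemma HasRates.eventually_hasWalk_of_forall_mem_supp (hr : HasRates A g r) (hl : l ∈ ultN A ν)
    (hx : ∀ j ∈ ultN A ν, x ∈ supp (mulVec (ultTerm A ν 1) (unitVec j))) :
    ∀ᶠ t in atTop, HasWalk (edge A) t x l := by
  refine eventually_hasWalk_of_forall_hasWalkMod (fun s => ?_)
    (eventually_hasWalk_self_of_mem_ultN hl)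
  obtain ⟨j, hj, hjl⟩ := (mem_critNodes_iff_onCycle.1 hl).exists_hasWalkMod_to (s - 1)
  have hj : j ∈ ultN A ν := mem_critNodes_iff_onCycle.2 hj
  simpa using ((hr.mem_supp_ultTerm_iff hj).1 (hx j hj)).trans
    (hjl.mono fun _ _ => edge_of_critEdge_ultA)

lemma HasRates.eventually_hasWalk_of_mem_access (hr : HasRates A g r)
    (hsupp : ∀ μ ∈ ultIndex A, ∀ ν ∈ ultIndex A, ultLam A μ < ultLam A ν →
      (⋃ i ∈ ultN A μ, supp (mulVec (ultTerm A μ 1) (unitVec i))) ⊆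
        ⋂ j ∈ ultN A ν, supp (mulVec (ultTerm A ν 1) (unitVec j)))
    (hl : OnCycle (edge A) l) (hx : x ∈ access A r (Set.Iio (r l))) :
    ∀ᶠ t in atTop, HasWalk (edge A) t x l := by
  obtain ⟨k, hk, hkl : r k < r l, hxk⟩ := hx
  obtain ⟨μ, k', hk', hkk'⟩ := hk.exists_hit
  obtain ⟨ν, l', hl', hll'⟩ := hl.exists_hit
  rw [hr.eq_ultLam_of_sameComp hk' hkk', hr.eq_ultLam_of_sameComp hl' hll'] at hkl
  obtain ⟨i, hi, hxi⟩ := hr.exists_mem_supp_ultTerm hk' (hxk.trans hkk'.1)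
  have hxν := hsupp μ (mem_ultIndex_of_mem_ultN hk') ν (mem_ultIndex_of_mem_ultN hl') hkl
    (Set.mem_biUnion hi hxi)
  exact eventually_hasWalk_trans
    (hr.eventually_hasWalk_of_forall_mem_supp hl' (Set.mem_iInter₂.1 hxν)) hll'.2

end OrbitPeriodicity

end MaxAlg

theorem theorem7p5 (n : ℕ) (A : Matrix (Fin n) (Fin n) ℝ≥0)
    (hA : ∀ i, MaxAlg.OnCycle (MaxAlg.edge A) i →
      MaxAlg.UltLinPeriodic A (MaxAlg.unitVec i)) :
    MaxAlg.OrbitPeriodic A ↔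
      ∀ μ ∈ MaxAlg.ultIndex A, ∀ ν ∈ MaxAlg.ultIndex A,
        MaxAlg.ultLam A μ < MaxAlg.ultLam A ν →
          (⋃ i ∈ MaxAlg.ultN A μ,
              MaxAlg.supp (MaxAlg.mulVec (MaxAlg.ultTerm A μ 1) (MaxAlg.unitVec i))) ⊆
            ⋂ j ∈ MaxAlg.ultN A ν,
              MaxAlg.supp (MaxAlg.mulVec (MaxAlg.ultTerm A ν 1) (MaxAlg.unitVec j)) := by
  obtain ⟨r, hr⟩ := MaxAlg.exists_hasRates hA
  constructor
  · intro h μ _ ν _ hlt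
    exact Set.iUnion₂_subset fun i hi => Set.subset_iInter₂ fun j hj =>
      h.supp_ultTerm_subset hr hlt hi hj
  · intro hsupp y
    obtain ⟨ρ, hρ⟩ := MaxAlg.exists_tame_orbit hr
      (fun l hl x hx => hr.eventually_hasWalk_of_mem_access hsupp hl hx) y
    exact MaxAlg.ultLinPeriodic_iff.2 ⟨ρ, hρ.geometric⟩
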